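/- Let $n,\ell\in\mathbb N$ with $n\le 4$ and $\ell\ge 2$, let $m_0\ge 0$ and $m_1,\dots,m_n>0$, and take the gravitational constant equal to $1$. For radii $0<r_1<\dots<r_n$, the associated $n\times\ell+1$ spiderweb consists of a body of mass $m_0$ at the origin and, for each $i\in\{1,\dots,n\}$ and $k\in\{0,\dots,\ell-1\}$, a body of mass $m_i$ at the point $r_i(\cos\frac{2\pi k}{\ell},\sin\frac{2\pi k}{\ell},0)\in\mathbb R^3$. Bodies with masses $\mu_a$ at pairwise distinct positions $q_a\in\mathbb R^3$ form a central configuration with constant $\lambda\in\mathbb R$ if $$-\sum_{b\ne a}\frac{\mu_b\,(q_a-q_b)}{|q_a-q_b|^3}=\lambda\, q_a\qquad\text{for every body } a.$$ (1) For every $\lambda<0$ there exist radii $0<r_1<\dots<r_n$ whose $n\times\ell+1$ spiderweb is a central configuration with constant $\lambda$. In particular, an $n\times\ell+1$ spiderweb central configuration exists. (2) If $n=2$, then for each fixed $\lambda$ there is at most one pair of radii $0<r_1<r_2$ whose $2\times\ell+1$ spiderweb is a central configuration with constant $\lambda$; hence for each $\lambda<0$ there is exactly one. -/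

import Mathlib

/-- Newtonian acceleration (gravitational constant `G = 1`) of the `i`-th of finitely many bodies
with masses `m` and positions `q` in `ℝ³`:
`q̈ᵢ = - ∑_{j ≠ i} mⱼ (qᵢ - qⱼ) / |qᵢ - qⱼ|³`.
The mass of the `i`-th body itself has been divided out, so the formula also makes sense for a body
of mass zero. -/
noncomputable def newtonAcceleration {ι : Type*} [Fintype ι] [DecidableEq ι]
    (m : ι → ℝ) (q : ι → EuclideanSpace ℝ (Fin 3)) (i : ι) : EuclideanSpace ℝ (Fin 3) :=
  -∑ j ∈ Finset.univ.erase i, (m j / ‖q i - q j‖ ^ 3) • (q i - q j)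

/-- Bodies with masses `m` at the pairwise distinct positions `q` form a central configuration
with constant `lam`: the acceleration of every body is `lam` times its position. -/
def IsCentralConfiguration {ι : Type*} [Fintype ι] [DecidableEq ι]
    (m : ι → ℝ) (q : ι → EuclideanSpace ℝ (Fin 3)) (lam : ℝ) : Prop :=
  Function.Injective q ∧ ∀ i, newtonAcceleration m q i = lam • q i

/-- The admissible vectors of radii: `0 < r₁ < ⋯ < rₙ`. -/
def orderedRadii (n : ℕ) : Set (Fin n → ℝ) :=
  {r | (∀ i, 0 < r i) ∧ StrictMono r}

/-- Positions of the `n × ℓ + 1` bodies of a spiderweb: the body `none` is at the origin, and the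
body `some (i, k)` is at the intersection of the circle of radius `r i` with the half-line of angle
`2 π k / ℓ` in the horizontal plane, `k = 0, …, ℓ - 1`. -/
noncomputable def spiderwebPosition {n ℓ : ℕ} (r : Fin n → ℝ) :
    Option (Fin n × Fin ℓ) → EuclideanSpace ℝ (Fin 3)
  | none => 0
  | some (i, k) =>
      !₂[r i * Real.cos (2 * Real.pi * (k : ℕ) / ℓ), r i * Real.sin (2 * Real.pi * (k : ℕ) / ℓ), 0]

/-- Masses of the `n × ℓ + 1` bodies of a spiderweb: `m₀` at the origin, and `m i` for each of the
`ℓ` bodies on the `i`-th circle. -/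
def spiderwebMass {n ℓ : ℕ} (m₀ : ℝ) (m : Fin n → ℝ) : Option (Fin n × Fin ℓ) → ℝ
  | none => m₀
  | some (i, _) => m i

/-- The radii `r` (with `0 < r₁ < ⋯ < rₙ`) give an `n × ℓ + 1` spiderweb central configuration with
central mass `m₀`, masses `m` on the circles, and constant `lam`. -/
def IsSpiderwebCentralConfiguration (n ℓ : ℕ) (m₀ : ℝ) (m : Fin n → ℝ) (lam : ℝ)
    (r : Fin n → ℝ) : Prop :=
  r ∈ orderedRadii n ∧
    IsCentralConfiguration (spiderwebMass (ℓ := ℓ) m₀ m) (spiderwebPosition (ℓ := ℓ) r) lam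

/-! The dihedral symmetry of a spiderweb puts the central body in equilibrium and makes every other
acceleration radial. What remains is one scalar equation per circle
(`isSpiderwebCentralConfiguration_iff`), and these say that `r` is a critical point of `F = U - (lam
* ℓ / 2) * ∑ m i * r i ^ 2` on the open cone of ordered radii, with `U` the potential.

Existence: for `lam < 0`, `F` blows up at collisions and at infinity, so it has a minimum.

Uniqueness: put `r i = exp (u i)`. For `x < y`, the mutual potential of two rings is a series in `x
^ N * y⁻¹ ^ (N + 1)` with nonnegative coefficients (`hasSum_sum_inv_norm_sub`), that is, a positive
combination of exponentials of linear forms in `u`. So `U` is convex in `u`, and the derivative of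
`U` along the logarithmic segment from one solution to another does not decrease. The equations turn
this into `0 ≤ lam * ∑ m i * (log r' i - log r i) * (r' i ^ 2 - r i ^ 2)`. Since `lam < 0`, every
summand vanishes and the solutions agree. -/

/-! ### The Newtonian potential and its gradient -/

/-- The derivative of the reciprocal of the norm along a curve. -/
theorem hasDerivAt_inv_norm {E : Type*} [NormedAddCommGroup E] [InnerProductSpace ℝ E]
    {v : ℝ → E} {v' : E} {t : ℝ} (hv : HasDerivAt v v' t) (h : v t ≠ 0) :
    HasDerivAt (fun s => ‖v s‖⁻¹) (-(inner ℝ (v t) v' / ‖v t‖ ^ 3)) t := by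
  have hn : ‖v t‖ ≠ 0 := norm_ne_zero_iff.mpr h
  have h1 := (hv.norm_sq.sqrt (pow_ne_zero 2 hn)).fun_inv
    (by rw [Real.sqrt_sq (norm_nonneg _)]; exact hn)
  simp only [Real.sqrt_sq (norm_nonneg _)] at h1
  refine h1.congr_deriv ?_
  field_simp

/-- The (positive) Newtonian potential of bodies with masses `m` at the positions `q`. The diagonal
terms vanish because `0⁻¹ = 0`. -/
noncomputable def newtonPotential {ι E : Type*} [Fintype ι] [NormedAddCommGroup E]
    (m : ι → ℝ) (q : ι → E) : ℝ :=
  2⁻¹ * ∑ a, ∑ b, m a * m b * ‖q a - q b‖⁻¹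

section General

variable {ι : Type*} [Fintype ι] [DecidableEq ι]

theorem newtonAcceleration_eq_sum (m : ι → ℝ) (q : ι → EuclideanSpace ℝ (Fin 3)) (i : ι) :
    newtonAcceleration m q i = -∑ j, (m j / ‖q i - q j‖ ^ 3) • (q i - q j) := by
  rw [newtonAcceleration, Finset.sum_erase _ (by simp)]

/-- The acceleration is the gradient of the potential. -/
theorem hasDerivAt_newtonPotential (m : ι → ℝ) {q : ℝ → ι → EuclideanSpace ℝ (Fin 3)}
    {q' : ι → EuclideanSpace ℝ (Fin 3)} {t : ℝ}
    (hq : ∀ a, HasDerivAt (fun s => q s a) (q' a) t) (hinj : Function.Injective (q t)) :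
    HasDerivAt (fun s => newtonPotential m (q s))
      (∑ a, m a * inner ℝ (newtonAcceleration m (q t) a) (q' a)) t := by
  have hpair : ∀ a b, HasDerivAt (fun s => m a * m b * ‖q s a - q s b‖⁻¹)
      (m a * m b * -(inner ℝ (q t a - q t b) (q' a - q' b) / ‖q t a - q t b‖ ^ 3)) t := by
    intro a b
    by_cases hab : a = b
    · subst hab
      simpa using hasDerivAt_const t (0 : ℝ)
    · exact (hasDerivAt_inv_norm ((hq a).fun_sub (hq b)) (sub_ne_zero.mpr (hinj.ne hab))).const_mul _
  have hsum := (HasDerivAt.fun_sum fun a (_ : a ∈ Finset.univ) =>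
    HasDerivAt.fun_sum fun b (_ : b ∈ Finset.univ) => hpair a b).const_mul (2⁻¹ : ℝ)
  refine hsum.congr_deriv ?_
  -- `T a b` is the part of the derivative of the pair term due to the motion of `a`. The part due
  -- to `b` is `T b a`, so symmetrising cancels the factor `2⁻¹`.
  set T : ι → ι → ℝ := fun a b =>
    m a * m b * -(inner ℝ (q t a - q t b) (q' a) / ‖q t a - q t b‖ ^ 3) with hT
  have hsplit : ∀ a b, m a * m b *
      -(inner ℝ (q t a - q t b) (q' a - q' b) / ‖q t a - q t b‖ ^ 3) = T a b + T b a := by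
    intro a b
    simp only [hT]
    rw [norm_sub_rev (q t b), ← neg_sub (q t a) (q t b), inner_neg_left, inner_sub_right]
    ring
  simp only [hsplit, Finset.sum_add_distrib]
  rw [Finset.sum_comm (f := fun a b => T b a), ← two_mul, inv_mul_cancel_left₀ two_ne_zero]
  refine Finset.sum_congr rfl fun a _ => ?_
  rw [newtonAcceleration_eq_sum, inner_neg_left, sum_inner, mul_neg, Finset.mul_sum,
    ← Finset.sum_neg_distrib]
  refine Finset.sum_congr rfl fun b _ => ?_
  rw [real_inner_smul_left]
  simp only [hT]
  ring

/-- Symmetries of a configuration are symmetries of the accelerations. -/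
theorem newtonAcceleration_equivariant (m : ι → ℝ) (q : ι → EuclideanSpace ℝ (Fin 3))
    (L : EuclideanSpace ℝ (Fin 3) →ₗᵢ[ℝ] EuclideanSpace ℝ (Fin 3)) (σ : Equiv.Perm ι)
    (hm : ∀ a, m (σ a) = m a) (hq : ∀ a, q (σ a) = L (q a)) (a : ι) :
    newtonAcceleration m q (σ a) = L (newtonAcceleration m q a) := by
  rw [newtonAcceleration_eq_sum, newtonAcceleration_eq_sum, map_neg, map_sum, ← Equiv.sum_comp σ]
  simp only [hm, hq, ← map_sub, L.norm_map, map_smul]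

end General

/-! ### The horizontal plane, its symmetries, and roots of unity -/

/-- The horizontal plane of `ℝ³` as an isometric copy of `ℂ`. -/
noncomputable def horizontal : ℂ →ₗᵢ[ℝ] EuclideanSpace ℝ (Fin 3) where
  toFun z := !₂[z.re, z.im, 0]
  map_add' z w := by ext i; fin_cases i <;> simp
  map_smul' c z := by ext i; fin_cases i <;> simp
  norm_map' z := by
    simp [EuclideanSpace.norm_eq, Fin.sum_univ_three, Complex.norm_eq_sqrt_sq_add_sq]

theorem horizontal_apply (z : ℂ) : horizontal z = !₂[z.re, z.im, 0] := rfl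

/-- Rotation about the vertical axis by the argument of a complex number of norm one. -/
noncomputable def verticalRotation (w : ℂ) (hw : ‖w‖ = 1) :
    EuclideanSpace ℝ (Fin 3) →ₗᵢ[ℝ] EuclideanSpace ℝ (Fin 3) where
  toFun v := !₂[w.re * v 0 - w.im * v 1, w.im * v 0 + w.re * v 1, v 2]
  map_add' v v' := by ext i; fin_cases i <;> simp <;> ring
  map_smul' c v := by ext i; fin_cases i <;> simp <;> ring
  norm_map' v := by
    have h : w.re ^ 2 + w.im ^ 2 = 1 := by
      rw [← Complex.sq_norm_sub_sq_re w, hw]; ring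
    simp only [EuclideanSpace.norm_eq, Fin.sum_univ_three, Real.norm_eq_abs, sq_abs]
    congr 1
    simp
    linear_combination (v 0 ^ 2 + v 1 ^ 2) * h

theorem verticalRotation_apply (w : ℂ) (hw : ‖w‖ = 1) (v : EuclideanSpace ℝ (Fin 3)) :
    verticalRotation w hw v = !₂[w.re * v 0 - w.im * v 1, w.im * v 0 + w.re * v 1, v 2] := rfl

theorem verticalRotation_horizontal (w : ℂ) (hw : ‖w‖ = 1) (z : ℂ) :
    verticalRotation w hw (horizontal z) = horizontal (w * z) := by
  ext i; fin_cases i <;> simp [verticalRotation_apply, horizontal_apply]; ring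

/-- The half-turn about the first coordinate axis. -/
noncomputable def halfTurn : EuclideanSpace ℝ (Fin 3) →ₗᵢ[ℝ] EuclideanSpace ℝ (Fin 3) where
  toFun v := !₂[v 0, -v 1, -v 2]
  map_add' v v' := by ext i; fin_cases i <;> simp <;> ring
  map_smul' c v := by ext i; fin_cases i <;> simp
  norm_map' v := by simp [EuclideanSpace.norm_eq, Fin.sum_univ_three]

theorem halfTurn_apply (v : EuclideanSpace ℝ (Fin 3)) : halfTurn v = !₂[v 0, -v 1, -v 2] := rfl

theorem halfTurn_horizontal (z : ℂ) :
    halfTurn (horizontal z) = horizontal (starRingEnd ℂ z) := by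
  ext i; fin_cases i <;> simp [halfTurn_apply, horizontal_apply]

/-- Unlike a reflection in a vertical plane, the half-turn also reverses the third coordinate, so
this one symmetry removes both components transverse to the first axis. -/
theorem eq_horizontal_of_halfTurn_eq {v : EuclideanSpace ℝ (Fin 3)} (h : halfTurn v = v) :
    v = horizontal (v 0 : ℝ) := by
  have h1 := congrArg (fun u => u 1) h
  have h2 := congrArg (fun u => u 2) h
  simp [halfTurn_apply] at h1 h2
  ext i; fin_cases i
  · simp [horizontal_apply]
  · simp [horizontal_apply]; linarith
  · simp [horizontal_apply]; linarith

/-- The `ℓ`-th roots of unity, indexed by `Fin ℓ`. -/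
noncomputable def rootOfUnity (ℓ : ℕ) (k : Fin ℓ) : ℂ :=
  Complex.exp (2 * Real.pi * Complex.I / ℓ) ^ (k : ℕ)

theorem norm_rootOfUnity {ℓ : ℕ} (k : Fin ℓ) : ‖rootOfUnity ℓ k‖ = 1 := by
  have : Complex.exp (2 * Real.pi * Complex.I / ℓ) =
      Complex.exp ((2 * Real.pi / ℓ : ℝ) * Complex.I) := by congr 1; push_cast; ring
  rw [rootOfUnity, norm_pow, this, Complex.norm_exp_ofReal_mul_I, one_pow]

theorem rootOfUnity_injective (ℓ : ℕ) : Function.Injective (rootOfUnity ℓ) := by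
  intro k k' h
  have hℓ : ℓ ≠ 0 := by rintro rfl; exact k.elim0
  exact Fin.ext ((Complex.isPrimitiveRoot_exp ℓ hℓ).pow_inj k.2 k'.2 h)

theorem rootOfUnity_zero (ℓ : ℕ) [NeZero ℓ] : rootOfUnity ℓ 0 = 1 := by simp [rootOfUnity]

theorem rootOfUnity_add {ℓ : ℕ} (k k' : Fin ℓ) :
    rootOfUnity ℓ (k + k') = rootOfUnity ℓ k * rootOfUnity ℓ k' := by
  have hℓ : ℓ ≠ 0 := by rintro rfl; exact k.elim0
  have h1 := (Complex.isPrimitiveRoot_exp ℓ hℓ).pow_eq_one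
  rw [rootOfUnity, Fin.val_add, ← pow_eq_pow_mod _ h1, pow_add, rootOfUnity, rootOfUnity]

theorem rootOfUnity_neg {ℓ : ℕ} [NeZero ℓ] (k : Fin ℓ) :
    rootOfUnity ℓ (-k) = starRingEnd ℂ (rootOfUnity ℓ k) := by
  have h : rootOfUnity ℓ (-k) * rootOfUnity ℓ k = 1 := by
    rw [← rootOfUnity_add, neg_add_cancel, rootOfUnity_zero]
  rw [eq_inv_of_mul_eq_one_left h, Complex.inv_def, Complex.normSq_eq_norm_sq, norm_rootOfUnity]
  simp

/-! ### Reduction to radial equations -/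

section Spiderweb

variable {n ℓ : ℕ}

theorem spiderwebPosition_none (r : Fin n → ℝ) : spiderwebPosition (ℓ := ℓ) r none = 0 := rfl

theorem spiderwebPosition_some (r : Fin n → ℝ) (i : Fin n) (k : Fin ℓ) :
    spiderwebPosition r (some (i, k)) = r i • horizontal (rootOfUnity ℓ k) := by
  have h : rootOfUnity ℓ k = Complex.exp ((2 * Real.pi * (k : ℕ) / ℓ : ℝ) * Complex.I) := by
    rw [rootOfUnity, ← Complex.exp_nat_mul]; congr 1; push_cast; ring
  ext j
  fin_cases j <;>
    simp [spiderwebPosition, horizontal_apply, h, Complex.exp_ofReal_mul_I_re,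
      Complex.exp_ofReal_mul_I_im, -Complex.ofReal_mul, -Complex.ofReal_div]

theorem spiderwebPosition_some' (r : Fin n → ℝ) (i : Fin n) (k : Fin ℓ) :
    spiderwebPosition r (some (i, k)) = horizontal (r i * rootOfUnity ℓ k) := by
  rw [spiderwebPosition_some, ← map_smul, Complex.real_smul]

theorem norm_spiderwebPosition_some {r : Fin n → ℝ} {i : Fin n} (hr : 0 < r i) (k : Fin ℓ) :
    ‖spiderwebPosition r (some (i, k))‖ = r i := by
  rw [spiderwebPosition_some, norm_smul, LinearIsometry.norm_map, norm_rootOfUnity,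
    Real.norm_of_nonneg hr.le, mul_one]

theorem spiderwebPosition_injective {r : Fin n → ℝ} (hr : r ∈ orderedRadii n) :
    Function.Injective (spiderwebPosition (ℓ := ℓ) r) := by
  have h0 : ∀ i (k : Fin ℓ), spiderwebPosition r (some (i, k)) ≠ 0 := fun i k h => by
    have := norm_spiderwebPosition_some (hr.1 i) k
    rw [h, norm_zero] at this
    exact (hr.1 i).ne this
  rintro (_ | ⟨i, k⟩) (_ | ⟨j, k'⟩) h
  · rfl
  · exact (h0 j k' h.symm).elim
  · exact (h0 i k h).elim
  · have hij : i = j := hr.2.injective <| by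
      rw [← norm_spiderwebPosition_some (hr.1 i) k, h, norm_spiderwebPosition_some (hr.1 j)]
    subst hij
    rw [spiderwebPosition_some, spiderwebPosition_some] at h
    rw [rootOfUnity_injective ℓ (horizontal.injective (smul_right_injective _ (hr.1 i).ne' h))]

/-- A permutation of the rays, acting on the bodies of a spiderweb. -/
def rayPerm (n : ℕ) {ℓ : ℕ} (σ : Equiv.Perm (Fin ℓ)) : Equiv.Perm (Option (Fin n × Fin ℓ)) :=
  Equiv.optionCongr ((Equiv.refl _).prodCongr σ)

theorem rayPerm_none (σ : Equiv.Perm (Fin ℓ)) : rayPerm n σ none = none := rfl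

theorem rayPerm_some (σ : Equiv.Perm (Fin ℓ)) (i : Fin n) (k : Fin ℓ) :
    rayPerm n σ (some (i, k)) = some (i, σ k) := rfl

theorem newtonAcceleration_spiderweb_rayPerm (m₀ : ℝ) (m r : Fin n → ℝ)
    (σ : Equiv.Perm (Fin ℓ))
    (L : EuclideanSpace ℝ (Fin 3) →ₗᵢ[ℝ] EuclideanSpace ℝ (Fin 3))
    (hL : ∀ k, L (horizontal (rootOfUnity ℓ k)) = horizontal (rootOfUnity ℓ (σ k)))
    (a : Option (Fin n × Fin ℓ)) :
    newtonAcceleration (spiderwebMass m₀ m) (spiderwebPosition r) (rayPerm n σ a) =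
      L (newtonAcceleration (spiderwebMass m₀ m) (spiderwebPosition r) a) := by
  refine newtonAcceleration_equivariant _ _ L _ ?_ ?_ a
  · rintro (_ | ⟨i, k⟩) <;> rfl
  · rintro (_ | ⟨i, k⟩)
    · rw [rayPerm_none, spiderwebPosition_none, map_zero]
    · rw [rayPerm_some, spiderwebPosition_some, spiderwebPosition_some, map_smul, hL]

theorem newtonAcceleration_spiderweb_neg [NeZero ℓ] (m₀ : ℝ) (m r : Fin n → ℝ)
    (a : Option (Fin n × Fin ℓ)) :
    newtonAcceleration (spiderwebMass m₀ m) (spiderwebPosition r) (rayPerm n (Equiv.neg _) a) =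
      halfTurn (newtonAcceleration (spiderwebMass m₀ m) (spiderwebPosition r) a) :=
  newtonAcceleration_spiderweb_rayPerm m₀ m r _ _
    (fun k => by rw [halfTurn_horizontal, Equiv.neg_apply, rootOfUnity_neg]) a

theorem newtonAcceleration_spiderweb_add [NeZero ℓ] (m₀ : ℝ) (m r : Fin n → ℝ) (k : Fin ℓ)
    (a : Option (Fin n × Fin ℓ)) :
    newtonAcceleration (spiderwebMass m₀ m) (spiderwebPosition r)
        (rayPerm n (Equiv.addLeft k) a) =
      verticalRotation _ (norm_rootOfUnity k)
        (newtonAcceleration (spiderwebMass m₀ m) (spiderwebPosition r) a) :=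
  newtonAcceleration_spiderweb_rayPerm m₀ m r _ _
    (fun k' => by rw [verticalRotation_horizontal, Equiv.coe_addLeft, rootOfUnity_add]) a

/-- The central body of a spiderweb is in equilibrium. -/
theorem newtonAcceleration_spiderweb_none (hℓ : 2 ≤ ℓ) (m₀ : ℝ) (m r : Fin n → ℝ) :
    newtonAcceleration (spiderwebMass (ℓ := ℓ) m₀ m) (spiderwebPosition r) none = 0 := by
  have : NeZero ℓ := ⟨by omega⟩
  have h1 := newtonAcceleration_spiderweb_neg (ℓ := ℓ) m₀ m r none
  have h2 := newtonAcceleration_spiderweb_add m₀ m r (⟨1, hℓ⟩ : Fin ℓ) none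
  rw [rayPerm_none] at h1 h2
  -- The acceleration of the centre is now a complex number `z` with `ω * z = z`, where `ω ≠ 1`
  -- because `ℓ ≥ 2`; hence `z = 0`.
  rw [eq_horizontal_of_halfTurn_eq h1.symm, verticalRotation_horizontal] at h2
  rw [eq_horizontal_of_halfTurn_eq h1.symm]
  have h3 := horizontal.injective h2
  have hne : rootOfUnity ℓ ⟨1, hℓ⟩ ≠ 1 := by
    rw [← rootOfUnity_zero ℓ]
    exact (rootOfUnity_injective ℓ).ne (by simp [Fin.ext_iff])
  rw [by_contra fun h0 => hne ((right_eq_mul₀ h0).mp h3), map_zero]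

/-- The radial component of the acceleration of the bodies on the `i`-th circle. -/
noncomputable def radialAcceleration (ℓ : ℕ) [NeZero ℓ] (m₀ : ℝ) (m r : Fin n → ℝ)
    (i : Fin n) : ℝ :=
  newtonAcceleration (spiderwebMass (ℓ := ℓ) m₀ m) (spiderwebPosition r) (some (i, 0)) 0

/-- The bodies on the circles of a spiderweb are accelerated radially. -/
theorem newtonAcceleration_spiderweb_some [NeZero ℓ] (m₀ : ℝ) (m r : Fin n → ℝ)
    (i : Fin n) (k : Fin ℓ) :
    newtonAcceleration (spiderwebMass m₀ m) (spiderwebPosition r) (some (i, k)) =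
      radialAcceleration ℓ m₀ m r i • horizontal (rootOfUnity ℓ k) := by
  have h1 := newtonAcceleration_spiderweb_neg (ℓ := ℓ) m₀ m r (some (i, 0))
  have h2 := newtonAcceleration_spiderweb_add m₀ m r k (some (i, 0))
  rw [rayPerm_some, Equiv.neg_apply, neg_zero] at h1
  rw [rayPerm_some, show Equiv.addLeft k 0 = k from add_zero k, eq_horizontal_of_halfTurn_eq h1.symm,
    verticalRotation_horizontal] at h2
  rw [h2, ← map_smul, Complex.real_smul, mul_comm, radialAcceleration]

/-- For the body `some (i, k)` both sides are multiples of the same nonzero vector, with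
coefficients independent of `k`; at the origin both sides vanish. -/
theorem isSpiderwebCentralConfiguration_iff [NeZero ℓ] (hℓ : 2 ≤ ℓ) (m₀ : ℝ) (m : Fin n → ℝ)
    (lam : ℝ) (r : Fin n → ℝ) :
    IsSpiderwebCentralConfiguration n ℓ m₀ m lam r ↔
      r ∈ orderedRadii n ∧ ∀ i, radialAcceleration ℓ m₀ m r i = lam * r i := by
  refine and_congr_right fun hr => ?_
  constructor
  · intro h i
    have := h.2 (some (i, 0))
    rw [newtonAcceleration_spiderweb_some, spiderwebPosition_some, smul_smul] at this
    refine smul_left_injective ℝ ?_ this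
    rw [rootOfUnity_zero, ← norm_ne_zero_iff]
    simp
  · refine fun h => ⟨spiderwebPosition_injective hr, ?_⟩
    rintro (_ | ⟨i, k⟩)
    · rw [newtonAcceleration_spiderweb_none hℓ, spiderwebPosition_none, smul_zero]
    · rw [newtonAcceleration_spiderweb_some, spiderwebPosition_some, smul_smul, h]

/-- The potential of a spiderweb as a function of the radii. -/
noncomputable def spiderwebPotential (ℓ : ℕ) (m₀ : ℝ) (m r : Fin n → ℝ) : ℝ :=
  newtonPotential (spiderwebMass (ℓ := ℓ) m₀ m) (spiderwebPosition r)

/-- Positions are linear in the radii, so velocities are positions with radii `c'`; the `ℓ` bodies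
of a circle contribute equally. The form along a curve serves coordinate variations, dilations and
logarithmic segments alike. -/
theorem hasDerivAt_spiderwebPotential [NeZero ℓ] (m₀ : ℝ) (m : Fin n → ℝ) {c : ℝ → Fin n → ℝ}
    {c' : Fin n → ℝ} {t : ℝ} (hc : ∀ i, HasDerivAt (fun s => c s i) (c' i) t)
    (hct : c t ∈ orderedRadii n) :
    HasDerivAt (fun s => spiderwebPotential ℓ m₀ m (c s))
      (ℓ * ∑ i, m i * (radialAcceleration ℓ m₀ m (c t) i * c' i)) t := by
  have h := hasDerivAt_newtonPotential (spiderwebMass (ℓ := ℓ) m₀ m)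
    (q := fun s => spiderwebPosition (c s))
    (q' := fun a => spiderwebPosition (ℓ := ℓ) c' a) (t := t) ?_ (spiderwebPosition_injective hct)
  · refine h.congr_deriv ?_
    rw [Fintype.sum_option, spiderwebPosition_none, inner_zero_right, mul_zero, zero_add,
      Fintype.sum_prod_type, Finset.mul_sum]
    refine Finset.sum_congr rfl fun i _ => ?_
    simp only [newtonAcceleration_spiderweb_some, spiderwebPosition_some, real_inner_smul_left,
      real_inner_smul_right, real_inner_self_eq_norm_sq, LinearIsometry.norm_map,
      norm_rootOfUnity, spiderwebMass, Finset.sum_const, Finset.card_univ, Fintype.card_fin,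
      nsmul_eq_mul]
    ring
  · rintro (_ | ⟨i, k⟩)
    · simpa only [spiderwebPosition_none] using hasDerivAt_const t _
    · simpa only [spiderwebPosition_some] using (hc i).smul_const _

end Spiderweb

/-! ### Power series expansion of the potential of two rings -/

-- These are the coefficients of `((1 - 4z)^(-1/2))² = 1/(1 - 4z)`. Under the swap of `p`, the
-- weight `p.1` averages to `n / 2`; the recursion for `(p + 1) * centralBinom (p + 1)` then reduces
-- the weighted sum for `n + 1` to sums for `n`.
open Finset in
theorem sum_antidiagonal_centralBinom_mul (n : ℕ) :
    ∑ p ∈ antidiagonal n, p.1.centralBinom * p.2.centralBinom = 4 ^ n := by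
  have hsymm : ∀ n, 2 * ∑ p ∈ antidiagonal n, p.1 * (p.1.centralBinom * p.2.centralBinom) =
      n * ∑ p ∈ antidiagonal n, p.1.centralBinom * p.2.centralBinom := by
    intro n
    rw [two_mul]
    nth_rewrite 2 [← Nat.sum_antidiagonal_swap]
    rw [← sum_add_distrib, mul_sum]
    refine sum_congr rfl fun p hp => ?_
    rw [← mem_antidiagonal.mp hp]
    simp only [Prod.fst_swap, Prod.snd_swap]
    ring
  induction n with
  | zero => simp
  | succ n ih =>
    have h1 := hsymm (n + 1)
    rw [Nat.sum_antidiagonal_succ] at h1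
    simp only [zero_mul, zero_add, ← mul_assoc, Nat.succ_mul_centralBinom_succ] at h1
    have h2 : ∑ p ∈ antidiagonal n, 2 * (2 * p.1 + 1) * p.1.centralBinom * p.2.centralBinom =
        2 * (2 * ∑ p ∈ antidiagonal n, p.1 * (p.1.centralBinom * p.2.centralBinom)) +
        2 * ∑ p ∈ antidiagonal n, p.1.centralBinom * p.2.centralBinom := by
      simp only [mul_sum, ← sum_add_distrib]
      exact sum_congr rfl fun p _ => by ring
    rw [h2, hsymm n, ih] at h1
    have : (n + 1) * (4 * 4 ^ n) = (n + 1) *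
      ∑ p ∈ antidiagonal (n + 1), p.1.centralBinom * p.2.centralBinom := by
      rw [← h1]; ring
    rw [pow_succ', Nat.eq_of_mul_eq_mul_left n.succ_pos this]

/-- The coefficients of the power series of `(1 - z) ^ (-1 / 2)`. -/
noncomputable def invSqrtCoeff (a : ℕ) : ℝ := a.centralBinom / 4 ^ a

theorem invSqrtCoeff_nonneg (a : ℕ) : 0 ≤ invSqrtCoeff a := by
  unfold invSqrtCoeff; positivity

open Finset in
theorem sum_antidiagonal_invSqrtCoeff_mul (n : ℕ) :
    ∑ p ∈ antidiagonal n, invSqrtCoeff p.1 * invSqrtCoeff p.2 = 1 := by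
  have h : ∀ p ∈ antidiagonal n, invSqrtCoeff p.1 * invSqrtCoeff p.2 =
      ((p.1.centralBinom * p.2.centralBinom : ℕ) : ℝ) / 4 ^ n := by
    intro p hp
    rw [← mem_antidiagonal.mp hp, pow_add]
    simp only [invSqrtCoeff]
    push_cast
    field_simp
  rw [sum_congr rfl h, ← sum_div, ← Nat.cast_sum, sum_antidiagonal_centralBinom_mul]
  simp

theorem invSqrtCoeff_le_one (a : ℕ) : invSqrtCoeff a ≤ 1 := by
  rw [← sum_antidiagonal_invSqrtCoeff_mul a]
  have := Finset.single_le_sum (f := fun p : ℕ × ℕ => invSqrtCoeff p.1 * invSqrtCoeff p.2)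
    (fun p _ => mul_nonneg (invSqrtCoeff_nonneg p.1) (invSqrtCoeff_nonneg p.2))
    (show (a, 0) ∈ Finset.HasAntidiagonal.antidiagonal a by simp)
  simpa [invSqrtCoeff] using this

theorem summable_norm_invSqrtCoeff_mul_pow {z : ℂ} (hz : ‖z‖ < 1) :
    Summable fun a => ‖(invSqrtCoeff a : ℂ) * z ^ a‖ := by
  refine Summable.of_nonneg_of_le (fun _ => norm_nonneg _) (fun a => ?_)
    (summable_geometric_of_lt_one (norm_nonneg z) hz)
  rw [norm_mul, norm_pow, Complex.norm_real, Real.norm_of_nonneg (invSqrtCoeff_nonneg a)]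
  exact mul_le_of_le_one_left (by positivity) (invSqrtCoeff_le_one a)

/-- Knowing the square of the series `f` is enough and avoids choosing a branch of the root: `f z *
conj (f z) = |f z ^ 2|`. -/
theorem sq_tsum_invSqrtCoeff_mul_pow {z : ℂ} (hz : ‖z‖ < 1) :
    (∑' a, (invSqrtCoeff a : ℂ) * z ^ a) ^ 2 = (1 - z)⁻¹ := by
  have hs := summable_norm_invSqrtCoeff_mul_pow hz
  rw [sq, tsum_mul_tsum_eq_tsum_sum_antidiagonal_of_summable_norm hs hs,
    ← tsum_geometric_of_norm_lt_one hz]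
  congr 1
  ext n
  rw [← one_mul (z ^ n), ← Complex.ofReal_one, ← sum_antidiagonal_invSqrtCoeff_mul n,
    Complex.ofReal_sum, Finset.sum_mul]
  refine Finset.sum_congr rfl fun p hp => ?_
  rw [← Finset.HasAntidiagonal.mem_antidiagonal.mp hp, pow_add]
  push_cast
  ring

theorem hasSum_mul_of_summable_norm {f g : ℕ → ℂ} (hf : Summable fun a => ‖f a‖)
    (hg : Summable fun a => ‖g a‖) :
    HasSum (fun p : ℕ × ℕ => f p.1 * g p.2) ((∑' a, f a) * ∑' a, g a) :=
  hf.of_norm.hasSum.mul hg.of_norm.hasSum (summable_mul_of_summable_norm hf hg)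

/-- The expansion of `1 / |1 - z|` as a double power series in `z` and its conjugate. -/
theorem hasSum_inv_norm_one_sub {z : ℂ} (hz : ‖z‖ < 1) :
    HasSum (fun p : ℕ × ℕ => ((invSqrtCoeff p.1 : ℂ) * z ^ p.1) *
      ((invSqrtCoeff p.2 : ℂ) * (starRingEnd ℂ z) ^ p.2)) ((‖1 - z‖⁻¹ : ℝ) : ℂ) := by
  have hz' : ‖starRingEnd ℂ z‖ < 1 := by rwa [RCLike.norm_conj]
  have hconj : (∑' a, (invSqrtCoeff a : ℂ) * (starRingEnd ℂ z) ^ a) =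
      starRingEnd ℂ (∑' a, (invSqrtCoeff a : ℂ) * z ^ a) := by
    rw [Complex.conj_tsum]
    refine tsum_congr fun a => ?_
    rw [map_mul, map_pow, Complex.conj_ofReal]
  have hval : (∑' a, (invSqrtCoeff a : ℂ) * z ^ a) *
      (∑' a, (invSqrtCoeff a : ℂ) * (starRingEnd ℂ z) ^ a) = ((‖1 - z‖⁻¹ : ℝ) : ℂ) := by
    rw [hconj, Complex.mul_conj, Complex.normSq_eq_norm_sq, ← norm_pow,
      sq_tsum_invSqrtCoeff_mul_pow hz, norm_inv]
  rw [← hval]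
  have h := hasSum_mul_of_summable_norm (summable_norm_invSqrtCoeff_mul_pow hz)
    (summable_norm_invSqrtCoeff_mul_pow hz')
  exact h

/-- The mutual potential of two families of points on concentric circles of radii `x < y` with
the same arguments is a series of monomials in `x` and `y⁻¹` with nonnegative coefficients. -/
theorem hasSum_sum_inv_norm_sub {κ : Type*} [Fintype κ] (w : κ → ℂ) (hw : ∀ k, ‖w k‖ = 1)
    {x y : ℝ} (hx : 0 < x) (hxy : x < y) :
    HasSum (fun p : ℕ × ℕ => (invSqrtCoeff p.1 * invSqrtCoeff p.2 *
      ‖∑ k, w k ^ p.1 * starRingEnd ℂ (w k) ^ p.2‖ ^ 2) * (x ^ (p.1 + p.2) * y⁻¹ ^ (p.1 + p.2 + 1)))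
      (∑ k, ∑ k', ‖(x : ℂ) * w k - y * w k'‖⁻¹) := by
  have hy : 0 < y := hx.trans hxy
  have hconj : ∀ k, w k * starRingEnd ℂ (w k) = 1 := fun k => by
    rw [Complex.mul_conj, Complex.normSq_eq_norm_sq, hw]; simp
  rw [← Complex.hasSum_ofReal]
  have hterm : ∀ k k', HasSum (fun p : ℕ × ℕ => (y⁻¹ : ℂ) *
      (((invSqrtCoeff p.1 : ℂ) * ((x / y : ℂ) * w k * starRingEnd ℂ (w k')) ^ p.1) *
      ((invSqrtCoeff p.2 : ℂ) *
        (starRingEnd ℂ ((x / y : ℂ) * w k * starRingEnd ℂ (w k'))) ^ p.2)))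
      ((‖(x : ℂ) * w k - y * w k'‖⁻¹ : ℝ) : ℂ) := by
    intro k k'
    have hz : ‖(x / y : ℂ) * w k * starRingEnd ℂ (w k')‖ < 1 := by
      simp only [norm_mul, norm_div, RCLike.norm_conj, hw, mul_one, Complex.norm_real,
        Real.norm_of_nonneg hx.le, Real.norm_of_nonneg hy.le]
      rwa [div_lt_one hy]
    have hfac : (x : ℂ) * w k - y * w k' =
        -(y * w k' * (1 - (x / y : ℂ) * w k * starRingEnd ℂ (w k'))) := by
      have : (y : ℂ) ≠ 0 := by exact_mod_cast hy.ne'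
      field_simp
      linear_combination (-(x : ℂ) * w k) * hconj k'
    rw [hfac, norm_neg, norm_mul, norm_mul, hw, mul_one, Complex.norm_real,
      Real.norm_of_nonneg hy.le, mul_inv]
    push_cast
    have := (hasSum_inv_norm_one_sub hz).mul_left (y⁻¹ : ℂ)
    simpa using this
  have := hasSum_sum fun k (_ : k ∈ Finset.univ) =>
    hasSum_sum fun k' (_ : k' ∈ Finset.univ) => hterm k k'
  push_cast at this ⊢
  convert this using 1
  ext p
  -- The source of positivity: for fixed exponents the double sum over `k, k'` is a power sum times
  -- its conjugate.
  have hS : ((‖∑ k, w k ^ p.1 * starRingEnd ℂ (w k) ^ p.2‖ : ℝ) : ℂ) ^ 2 =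
      ∑ k, ∑ k', (w k ^ p.1 * starRingEnd ℂ (w k) ^ p.2) *
        (starRingEnd ℂ (w k') ^ p.1 * w k' ^ p.2) := by
    rw [← Complex.mul_conj', map_sum, Finset.sum_mul_sum]
    simp
  rw [hS, Finset.mul_sum, Finset.sum_mul]
  refine Finset.sum_congr rfl fun k _ => ?_
  rw [Finset.mul_sum, Finset.sum_mul]
  refine Finset.sum_congr rfl fun k' _ => ?_
  simp only [map_mul, Complex.conj_ofReal, Complex.conj_conj, div_eq_mul_inv, mul_pow,
    pow_add, map_inv₀]
  ring

/-! ### Existence by minimisation -/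

theorem isOpen_orderedRadii (n : ℕ) : IsOpen (orderedRadii n) := by
  have h : orderedRadii n = (⋂ i : Fin n, {r | 0 < r i}) ∩
      ⋂ i : Fin n, ⋂ j : Fin n, {r | i < j → r i < r j} := by
    ext r
    simp [orderedRadii, StrictMono]
  rw [h]
  refine (isOpen_iInter_of_finite fun i => isOpen_lt continuous_const (continuous_apply i)).inter
    (isOpen_iInter_of_finite fun i => isOpen_iInter_of_finite fun j => ?_)
  by_cases hij : i < j
  · simpa [hij] using isOpen_lt (continuous_apply i) (continuous_apply j)
  · simp [hij]

theorem orderedRadii_nonempty (n : ℕ) : (orderedRadii n).Nonempty :=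
  ⟨fun i => (i : ℕ) + 1, fun i => by positivity, fun i j h => by simpa using h⟩

/-- A continuous function on the space of radii which blows up at collisions and at infinity
attains its minimum. -/
theorem exists_isMinOn_orderedRadii {n : ℕ} {F : (Fin n → ℝ) → ℝ} {A R : Fin n → ℝ}
    {B : Fin n → Fin n → ℝ} (hA : ∀ i, 0 < A i) (hR : ∀ i, 0 < R i) (hB : ∀ i j, 0 < B i j)
    (hF : ContinuousOn F (orderedRadii n)) (hF0 : ∀ r ∈ orderedRadii n, 0 ≤ F r)
    (hFA : ∀ r ∈ orderedRadii n, ∀ i, A i * (r i)⁻¹ ≤ F r)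
    (hFR : ∀ r ∈ orderedRadii n, ∀ i, R i * r i ^ 2 ≤ F r)
    (hFB : ∀ r ∈ orderedRadii n, ∀ i j, i < j → B i j * (r j - r i)⁻¹ ≤ F r) :
    ∃ r ∈ orderedRadii n, IsMinOn F (orderedRadii n) r := by
  obtain ⟨r₀, hr₀⟩ := orderedRadii_nonempty n
  set C := F r₀ with hC
  have hC0 : 0 ≤ C := hF0 r₀ hr₀
  -- The bounds implied by `F r ≤ C`, cleared of denominators: this makes `K` closed in the whole
  -- space, not only in the open cone.
  set K : Set (Fin n → ℝ) := (⋂ i, {r | A i ≤ r i * C}) ∩ (⋂ i, {r | R i * r i ^ 2 ≤ C}) ∩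
    ⋂ i, ⋂ j, {r | i < j → B i j ≤ (r j - r i) * C} with hK
  have hmemK : ∀ r, r ∈ K ↔ ((∀ i, A i ≤ r i * C) ∧ ∀ i, R i * r i ^ 2 ≤ C) ∧
      ∀ i j, i < j → B i j ≤ (r j - r i) * C := by
    intro r; simp [hK]
  have hKO : K ⊆ orderedRadii n := by
    intro r hr
    obtain ⟨⟨h1, -⟩, h3⟩ := (hmemK r).mp hr
    exact ⟨fun i => pos_of_mul_pos_left ((hA i).trans_le (h1 i)) hC0, fun i j hij =>
      sub_pos.mp (pos_of_mul_pos_left ((hB i j).trans_le (h3 i j hij)) hC0)⟩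
  have hOK : ∀ r ∈ orderedRadii n, F r ≤ C → r ∈ K := by
    intro r hr hrC
    refine (hmemK r).mpr ⟨⟨fun i => ?_, fun i => (hFR r hr i).trans hrC⟩, fun i j hij => ?_⟩
    · have := (hFA r hr i).trans hrC
      rwa [← div_eq_mul_inv, div_le_iff₀' (hr.1 i)] at this
    · have := (hFB r hr i j hij).trans hrC
      rwa [← div_eq_mul_inv, div_le_iff₀' (sub_pos.mpr (hr.2 hij))] at this
  have hclosed : IsClosed K := by
    refine ((isClosed_iInter fun i => isClosed_le continuous_const (by fun_prop)).inter
      (isClosed_iInter fun i => isClosed_le (by fun_prop) continuous_const)).inter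
      (isClosed_iInter fun i => isClosed_iInter fun j => ?_)
    by_cases hij : i < j
    · simp only [hij, forall_const]
      exact isClosed_le continuous_const (by fun_prop)
    · simp [hij]
  have hcompact : IsCompact K := by
    refine (isCompact_univ_pi fun i => isCompact_Icc (a := -√(C / R i)) (b := √(C / R i))
      ).of_isClosed_subset hclosed fun r hr i _ => ?_
    obtain ⟨⟨-, h2⟩, -⟩ := (hmemK r).mp hr
    exact abs_le.mp (Real.abs_le_sqrt ((le_div_iff₀' (hR i)).mpr (h2 i)))
  obtain ⟨r, hrK, hmin⟩ := hcompact.exists_isMinOn ⟨r₀, hOK r₀ hr₀ le_rfl⟩ (hF.mono hKO)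
  refine ⟨r, hKO hrK, fun s hs => ?_⟩
  rcases le_total (F s) C with h | h
  · exact hmin (hOK s hs h)
  · exact (hmin (hOK r₀ hr₀ le_rfl)).trans h

section Existence

variable {n ℓ : ℕ}

theorem spiderwebMass_nonneg {m₀ : ℝ} {m : Fin n → ℝ} (hm₀ : 0 ≤ m₀) (hm : ∀ i, 0 < m i)
    (a : Option (Fin n × Fin ℓ)) : 0 ≤ spiderwebMass m₀ m a := by
  rcases a with _ | ⟨i, k⟩
  · exact hm₀
  · exact (hm i).le

theorem newtonPotential_nonneg {ι E : Type*} [Fintype ι] [NormedAddCommGroup E] {m : ι → ℝ}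
    (hm : ∀ a, 0 ≤ m a) (q : ι → E) : 0 ≤ newtonPotential m q :=
  mul_nonneg (by norm_num) (Finset.sum_nonneg fun a _ => Finset.sum_nonneg fun b _ =>
    mul_nonneg (mul_nonneg (hm a) (hm b)) (by positivity))

theorem le_newtonPotential {ι E : Type*} [Fintype ι] [NormedAddCommGroup E] {m : ι → ℝ}
    (hm : ∀ a, 0 ≤ m a) (q : ι → E) (a b : ι) :
    2⁻¹ * (m a * m b * ‖q a - q b‖⁻¹) ≤ newtonPotential m q := by
  have h : ∀ a b, 0 ≤ m a * m b * ‖q a - q b‖⁻¹ := fun a b =>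
    mul_nonneg (mul_nonneg (hm a) (hm b)) (by positivity)
  refine mul_le_mul_of_nonneg_left ?_ (by norm_num)
  exact (Finset.single_le_sum (f := fun b => m a * m b * ‖q a - q b‖⁻¹) (fun b _ => h a b)
    (Finset.mem_univ b)).trans
    (Finset.single_le_sum (f := fun a => ∑ b, m a * m b * ‖q a - q b‖⁻¹)
      (fun a _ => Finset.sum_nonneg fun b _ => h a b) (Finset.mem_univ a))

theorem continuousOn_spiderwebPotential (ℓ : ℕ) (m₀ : ℝ) (m : Fin n → ℝ) :
    ContinuousOn (spiderwebPotential ℓ m₀ m) (orderedRadii n) := by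
  have hcont : ∀ a : Option (Fin n × Fin ℓ),
      Continuous fun r : Fin n → ℝ => spiderwebPosition r a := by
    rintro (_ | ⟨i, k⟩)
    · exact continuous_const
    · simp only [spiderwebPosition_some]
      fun_prop
  refine continuousOn_const.mul (continuousOn_finsetSum _ fun a _ =>
    continuousOn_finsetSum _ fun b _ => ?_)
  by_cases hab : a = b
  · subst hab
    simpa using continuousOn_const
  · refine continuousOn_const.mul (ContinuousOn.inv₀ (by fun_prop) fun r hr => ?_)
    exact norm_ne_zero_iff.mpr (sub_ne_zero.mpr ((spiderwebPosition_injective hr).ne hab))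

/-- For every negative constant there is a spiderweb central configuration: a minimum of the
potential augmented by a multiple of the moment of inertia. -/
theorem exists_isSpiderwebCentralConfiguration (hℓ : 2 ≤ ℓ) {m₀ : ℝ} {m : Fin n → ℝ}
    (hm₀ : 0 ≤ m₀) (hm : ∀ i, 0 < m i) {lam : ℝ} (hlam : lam < 0) :
    ∃ r, IsSpiderwebCentralConfiguration n ℓ m₀ m lam r := by
  have : NeZero ℓ := ⟨by omega⟩
  have hℓ0 : (0 : ℝ) < ℓ := by exact_mod_cast (by omega : 0 < ℓ)
  have hM := spiderwebMass_nonneg (ℓ := ℓ) hm₀ hm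
  -- Two bodies of the same circle, at distance `r i * ‖1 - ω‖`, keep `r i` away from `0` even if
  -- `m₀ = 0`.
  set ω := rootOfUnity ℓ ⟨1, hℓ⟩ with hω
  have hω1 : 0 < ‖1 - ω‖ := by
    rw [norm_pos_iff, sub_ne_zero, ← rootOfUnity_zero ℓ]
    exact (rootOfUnity_injective ℓ).ne (by simp [Fin.ext_iff])
  -- With this `κ`, the `i`-th partial derivative of `F` is `ℓ * m i * (radialAcceleration - lam * r
  -- i)`.
  set κ : ℝ := -lam * ℓ / 2 with hκ
  have hκ0 : 0 < κ := by have := mul_pos (neg_pos.mpr hlam) hℓ0; positivity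
  set F : (Fin n → ℝ) → ℝ := fun r =>
    spiderwebPotential ℓ m₀ m r + κ * ∑ i, m i * r i ^ 2 with hF
  have hI0 : ∀ r : Fin n → ℝ, ∀ i, 0 ≤ m i * r i ^ 2 := fun r i =>
    mul_nonneg (hm i).le (sq_nonneg _)
  have hI : ∀ r : Fin n → ℝ, 0 ≤ κ * ∑ i, m i * r i ^ 2 := fun r =>
    mul_nonneg hκ0.le (Finset.sum_nonneg fun i _ => hI0 r i)
  have hU : ∀ r : Fin n → ℝ, 0 ≤ spiderwebPotential ℓ m₀ m r := fun r =>
    newtonPotential_nonneg hM _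
  have hFcont : ContinuousOn F (orderedRadii n) :=
    (continuousOn_spiderwebPotential ℓ m₀ m).add (by fun_prop)
  have hFA : ∀ r ∈ orderedRadii n, ∀ i, 2⁻¹ * (m i * m i * ‖1 - ω‖⁻¹) * (r i)⁻¹ ≤ F r := by
    intro r hr i
    refine le_trans ?_ (le_add_of_nonneg_right (hI r))
    have h := le_newtonPotential hM (spiderwebPosition r) (some (i, 0)) (some (i, ⟨1, hℓ⟩))
    rw [spiderwebPosition_some, spiderwebPosition_some, ← smul_sub, ← map_sub, norm_smul,
      LinearIsometry.norm_map, Real.norm_of_nonneg (hr.1 i).le, rootOfUnity_zero, mul_inv] at h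
    refine le_of_eq_of_le ?_ h
    simp only [spiderwebMass]
    ring
  have hFR : ∀ r ∈ orderedRadii n, ∀ i, κ * m i * r i ^ 2 ≤ F r := by
    intro r hr i
    refine le_trans ?_ (le_add_of_nonneg_left (hU r))
    rw [mul_assoc]
    exact mul_le_mul_of_nonneg_left (Finset.single_le_sum (f := fun i => m i * r i ^ 2)
      (fun i _ => hI0 r i) (Finset.mem_univ i)) hκ0.le
  have hFB : ∀ r ∈ orderedRadii n, ∀ i j, i < j →
      2⁻¹ * (m i * m j) * (r j - r i)⁻¹ ≤ F r := by
    intro r hr i j hij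
    refine le_trans ?_ (le_add_of_nonneg_right (hI r))
    have h := le_newtonPotential hM (spiderwebPosition r) (some (i, 0)) (some (j, (0 : Fin ℓ)))
    rw [spiderwebPosition_some, spiderwebPosition_some, ← sub_smul, norm_smul,
      LinearIsometry.norm_map, norm_rootOfUnity, mul_one, Real.norm_eq_abs, abs_sub_comm,
      abs_of_pos (sub_pos.mpr (hr.2 hij))] at h
    refine le_of_eq_of_le ?_ h
    simp only [spiderwebMass]
    ring
  obtain ⟨r, hr, hmin⟩ := exists_isMinOn_orderedRadii (F := F)
    (A := fun i => 2⁻¹ * (m i * m i * ‖1 - ω‖⁻¹)) (R := fun i => κ * m i)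
    (B := fun i j => 2⁻¹ * (m i * m j))
    (fun i => by have := hm i; positivity) (fun i => mul_pos hκ0 (hm i))
    (fun i j => by have := hm i; have := hm j; positivity) hFcont
    (fun r _ => add_nonneg (hU r) (hI r)) hFA hFR hFB
  refine ⟨r, (isSpiderwebCentralConfiguration_iff hℓ m₀ m lam r).mpr ⟨hr, fun i => ?_⟩⟩
  set c : ℝ → Fin n → ℝ := fun s => Function.update r i (r i + s) with hc
  have hc0 : c 0 = r := by simp [hc]
  have hcd : ∀ j, HasDerivAt (fun s => c s j) ((Pi.single i 1 : Fin n → ℝ) j) 0 := by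
    intro j
    by_cases hj : j = i
    · subst hj
      simpa [hc] using (hasDerivAt_id (0 : ℝ)).const_add (r j)
    · simpa [hc, hj] using hasDerivAt_const (0 : ℝ) (r j)
  have hd := (hasDerivAt_spiderwebPotential (ℓ := ℓ) m₀ m hcd (hc0.symm ▸ hr)).fun_add
    ((HasDerivAt.fun_sum fun j (_ : j ∈ Finset.univ) =>
      ((hcd j).fun_pow 2).const_mul (m j)).const_mul κ)
  have hloc : IsLocalMin (fun s => F (c s)) 0 := by
    have hcc : ContinuousAt c 0 := continuousAt_pi.mpr fun j => (hcd j).continuousAt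
    have hev := hcc.eventually_mem ((isOpen_orderedRadii n).mem_nhds (hc0.symm ▸ hr))
    filter_upwards [hev] with s hs
    rw [hc0]
    exact hmin hs
  have h0 := hloc.hasDerivAt_eq_zero hd
  simp only [hc0, Pi.single_apply] at h0
  simp at h0
  have hmi := (hm i).ne'
  have hfac : (ℓ * m i) * (radialAcceleration ℓ m₀ m r i - lam * r i) = 0 := by
    rw [← h0, hκ]; ring
  have := (mul_eq_zero.mp hfac).resolve_left (mul_ne_zero hℓ0.ne' hmi)
  linarith

end Existence

/-! ### Convexity in logarithmic coordinates and uniqueness -/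

theorem convexOn_const_mul_exp_mul {w : ℝ} (hw : 0 ≤ w) (β : ℝ) {s : Set ℝ} (hs : Convex ℝ s) :
    ConvexOn ℝ s fun t => w * Real.exp (t * β) := by
  have h := (convexOn_exp.comp_linearMap (LinearMap.mulRight ℝ β)).smul hw
  exact h.subset (Set.subset_univ s) hs

theorem convexOn_finsetSum {ι E : Type*} [AddCommMonoid E] [Module ℝ E] (u : Finset ι)
    {s : Set E} (hs : Convex ℝ s) {f : ι → E → ℝ} (hf : ∀ i ∈ u, ConvexOn ℝ s (f i)) :
    ConvexOn ℝ s fun x => ∑ i ∈ u, f i x := by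
  induction u using Finset.cons_induction with
  | empty => simpa using convexOn_const (0 : ℝ) hs
  | cons a u ha ih =>
    simp only [Finset.sum_cons]
    exact (hf a (Finset.mem_cons_self a u)).add
      (ih fun i hi => hf i (Finset.mem_cons_of_mem hi))

/-- Jensen's inequality passes to pointwise sums; no uniform convergence is required. -/
theorem convexOn_of_hasSum {ι E : Type*} [AddCommMonoid E] [Module ℝ E]
    {s : Set E} (hs : Convex ℝ s) {f : ι → E → ℝ} {g : E → ℝ} (hf : ∀ i, ConvexOn ℝ s (f i))
    (hg : ∀ x ∈ s, HasSum (fun i => f i x) (g x)) : ConvexOn ℝ s g :=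
  ⟨hs, fun x hx y hy a b ha hb hab =>
    hasSum_le (fun i => (hf i).2 hx hy ha hb hab) (hg _ (hs hx hy ha hb hab))
      (((hg x hx).const_smul a).add ((hg y hy).const_smul b))⟩

theorem ConvexOn.le_of_hasDerivAt {s : Set ℝ} {g : ℝ → ℝ} (hg : ConvexOn ℝ s g) {x y : ℝ}
    (hx : x ∈ s) (hy : y ∈ s) (hxy : x < y) {g₀ g₁ : ℝ} (h₀ : HasDerivAt g g₀ x)
    (h₁ : HasDerivAt g g₁ y) : g₀ ≤ g₁ :=
  (hg.le_slope_of_hasDerivAt hx hy hxy h₀).trans (hg.slope_le_of_hasDerivAt hx hy hxy h₁)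

section Uniqueness

variable {n ℓ : ℕ}

/-- The mutual potential of two regular `ℓ`-gons of unit masses with radii `x` and `y`. -/
noncomputable def ringPotential (ℓ : ℕ) (x y : ℝ) : ℝ :=
  ∑ k, ∑ k', ‖(x : ℂ) * rootOfUnity ℓ k - y * rootOfUnity ℓ k'‖⁻¹

theorem ringPotential_comm (ℓ : ℕ) (x y : ℝ) : ringPotential ℓ x y = ringPotential ℓ y x := by
  rw [ringPotential, Finset.sum_comm]
  simp only [norm_sub_rev, ringPotential]

/-- Homogeneity of degree `-1`. It covers equal radii, where the series expansion is not available.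
-/
theorem ringPotential_self (ℓ : ℕ) {x : ℝ} (hx : 0 ≤ x) :
    ringPotential ℓ x x = ringPotential ℓ 1 1 * x⁻¹ := by
  simp only [ringPotential, Finset.sum_mul]
  refine Finset.sum_congr rfl fun k _ => Finset.sum_congr rfl fun k' _ => ?_
  rw [← mul_sub, norm_mul, Complex.norm_real, Real.norm_of_nonneg hx, mul_inv]
  simp [mul_comm]

theorem ringPotential_nonneg (ℓ : ℕ) (x y : ℝ) : 0 ≤ ringPotential ℓ x y :=
  Finset.sum_nonneg fun _ _ => Finset.sum_nonneg fun _ _ => by positivity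

theorem spiderwebPotential_eq (m₀ : ℝ) (m : Fin n → ℝ) {r : Fin n → ℝ} (hr : ∀ i, 0 < r i) :
    spiderwebPotential ℓ m₀ m r = 2⁻¹ * (2 * ∑ i, (ℓ * (m₀ * m i)) * (r i)⁻¹ +
      ∑ i, ∑ j, (m i * m j) * ringPotential ℓ (r i) (r j)) := by
  have hpair : ∀ i j, (m i * m j) * ringPotential ℓ (r i) (r j) = ∑ k : Fin ℓ, ∑ k' : Fin ℓ,
      m i * m j * ‖spiderwebPosition r (some (i, k)) - spiderwebPosition r (some (j, k'))‖⁻¹ := by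
    intro i j
    simp only [ringPotential, Finset.mul_sum, spiderwebPosition_some', ← map_sub,
      LinearIsometry.norm_map]
  simp only [hpair]
  rw [spiderwebPotential, newtonPotential]
  simp only [Fintype.sum_option, Fintype.sum_prod_type, spiderwebPosition_none, sub_zero, zero_sub,
    norm_neg, norm_zero, inv_zero, mul_zero, zero_add, norm_spiderwebPosition_some (hr _),
    spiderwebMass, Finset.sum_const, Finset.card_univ, Fintype.card_fin, nsmul_eq_mul,
    Finset.sum_add_distrib]
  congr 1
  rw [two_mul, add_assoc]
  congr 1
  · exact Finset.sum_congr rfl fun i _ => by ring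
  congr 1
  · exact Finset.sum_congr rfl fun i _ => by ring
  · exact Finset.sum_congr rfl fun i _ => Finset.sum_comm

/-- With `N = p.1 + p.2`, each monomial of the series becomes a nonnegative constant times `exp (t *
(N * a - (N + 1) * b))`. -/
theorem convexOn_ringPotential_exp_of_lt (ℓ : ℕ) {x y a b : ℝ} (hx : 0 < x) (hy : 0 < y)
    {s : Set ℝ} (hs : Convex ℝ s)
    (hlt : ∀ t ∈ s, x * Real.exp (t * a) < y * Real.exp (t * b)) :
    ConvexOn ℝ s fun t => ringPotential ℓ (x * Real.exp (t * a)) (y * Real.exp (t * b)) := by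
  refine convexOn_of_hasSum hs (ι := ℕ × ℕ) (f := fun p t => (invSqrtCoeff p.1 * invSqrtCoeff p.2 *
      ‖∑ k, rootOfUnity ℓ k ^ p.1 * starRingEnd ℂ (rootOfUnity ℓ k) ^ p.2‖ ^ 2 *
      (x ^ (p.1 + p.2) * y⁻¹ ^ (p.1 + p.2 + 1))) *
      Real.exp (t * ((p.1 + p.2 : ℕ) * a - (p.1 + p.2 + 1 : ℕ) * b))) (fun p => ?_) fun t ht => ?_
  · refine convexOn_const_mul_exp_mul ?_ _ hs
    have := invSqrtCoeff_nonneg p.1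
    have := invSqrtCoeff_nonneg p.2
    positivity
  · have h := hasSum_sum_inv_norm_sub (rootOfUnity ℓ) norm_rootOfUnity
      (mul_pos hx (Real.exp_pos (t * a))) (hlt t ht)
    refine h.congr_fun fun p => ?_
    have he : Real.exp (t * ((p.1 + p.2 : ℕ) * a - (p.1 + p.2 + 1 : ℕ) * b)) =
        Real.exp (t * a) ^ (p.1 + p.2) * (Real.exp (t * b))⁻¹ ^ (p.1 + p.2 + 1) := by
      rw [← Real.exp_neg, ← Real.exp_nat_mul, ← Real.exp_nat_mul, ← Real.exp_add]
      congr 1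
      ring
    rw [he, mul_inv, mul_pow, mul_pow]
    ring

/-- In logarithmic coordinates the potential of a spiderweb is convex. -/
theorem convexOn_spiderwebPotential_exp {m₀ : ℝ} {m : Fin n → ℝ} (hm₀ : 0 ≤ m₀)
    (hm : ∀ i, 0 < m i) {r d : Fin n → ℝ} {s : Set ℝ} (hs : Convex ℝ s) (hr : ∀ i, 0 < r i)
    (hrs : ∀ t ∈ s, (fun i => r i * Real.exp (t * d i)) ∈ orderedRadii n) :
    ConvexOn ℝ s fun t => spiderwebPotential ℓ m₀ m fun i => r i * Real.exp (t * d i) := by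
  have hinv : ∀ i, ConvexOn ℝ s fun t => (r i * Real.exp (t * d i))⁻¹ := by
    intro i
    refine (convexOn_const_mul_exp_mul (inv_pos.mpr (hr i)).le (-d i) hs).congr fun t _ => ?_
    simp only [mul_neg, Real.exp_neg, mul_inv]
  have hlt : ∀ i j, i < j → ConvexOn ℝ s fun t =>
      ringPotential ℓ (r i * Real.exp (t * d i)) (r j * Real.exp (t * d j)) := fun i j hij =>
    convexOn_ringPotential_exp_of_lt ℓ (hr i) (hr j) hs fun t ht => (hrs t ht).2 hij
  have hring : ∀ i j, ConvexOn ℝ s fun t =>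
      ringPotential ℓ (r i * Real.exp (t * d i)) (r j * Real.exp (t * d j)) := by
    intro i j
    rcases lt_trichotomy i j with hij | rfl | hij
    · exact hlt i j hij
    · refine ((hinv i).smul (ringPotential_nonneg ℓ 1 1)).congr fun t _ => ?_
      exact (ringPotential_self ℓ (mul_pos (hr i) (Real.exp_pos _)).le).symm
    · exact (hlt j i hij).congr fun t _ => ringPotential_comm ℓ _ _
  have hpos : ∀ t i, 0 < r i * Real.exp (t * d i) := fun t i => mul_pos (hr i) (Real.exp_pos _)
  simp only [spiderwebPotential_eq m₀ m (hpos _)]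
  refine ConvexOn.smul (by norm_num) (ConvexOn.add (ConvexOn.smul (by norm_num)
    (convexOn_finsetSum _ hs fun i _ => ConvexOn.smul ?_ (hinv i)))
    (convexOn_finsetSum _ hs fun i _ => convexOn_finsetSum _ hs fun j _ =>
      ConvexOn.smul (mul_pos (hm i) (hm j)).le (hring i j)))
  exact mul_nonneg (Nat.cast_nonneg _) (mul_nonneg hm₀ (hm i).le)

theorem hasDerivAt_mul_exp_mul (a b t : ℝ) :
    HasDerivAt (fun s => a * Real.exp (s * b)) (a * Real.exp (t * b) * b) t := by
  have h := (((hasDerivAt_id t).mul_const b).exp).const_mul a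
  refine h.congr_deriv ?_
  simp only [id, one_mul]
  ring

/-- The constant of a spiderweb central configuration with at least one circle is negative. -/
theorem neg_of_isSpiderwebCentralConfiguration (hℓ : 2 ≤ ℓ) {m₀ : ℝ} {m : Fin n → ℝ}
    (hm₀ : 0 ≤ m₀) (hm : ∀ i, 0 < m i) {lam : ℝ} {r : Fin n → ℝ}
    (h : IsSpiderwebCentralConfiguration n ℓ m₀ m lam r) (i₀ : Fin n) : lam < 0 := by
  have : NeZero ℓ := ⟨by omega⟩
  obtain ⟨hr, hcc⟩ := (isSpiderwebCentralConfiguration_iff hℓ m₀ m lam r).mp h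
  have hd := hasDerivAt_spiderwebPotential (ℓ := ℓ) m₀ m (c := fun s i => r i * Real.exp (s * 1))
    (t := 0) (fun i => hasDerivAt_mul_exp_mul (r i) 1 0) (by simpa using hr)
  -- Differentiating this homogeneity at `s = 0` gives Euler's identity `ℓ * lam * ∑ m i * r i ^ 2 =
  -- -U`, with `U > 0`.
  have hscale : ∀ s : ℝ, spiderwebPotential ℓ m₀ m (fun i => r i * Real.exp (s * 1)) =
      spiderwebPotential ℓ m₀ m r * Real.exp (s * -1) := by
    intro s
    have hq : ∀ a : Option (Fin n × Fin ℓ), spiderwebPosition (fun i => r i * Real.exp (s * 1)) a =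
        Real.exp s • spiderwebPosition r a := by
      rintro (_ | ⟨i, k⟩)
      · rw [spiderwebPosition_none, spiderwebPosition_none, smul_zero]
      · rw [spiderwebPosition_some, spiderwebPosition_some, smul_smul, mul_one, mul_comm]
    rw [spiderwebPotential, newtonPotential]
    simp only [hq]
    simp only [spiderwebPotential, newtonPotential, ← smul_sub, norm_smul, mul_inv,
      Real.norm_of_nonneg (Real.exp_pos s).le, Finset.mul_sum, Finset.sum_mul, mul_neg, mul_one,
      Real.exp_neg]
    exact Finset.sum_congr rfl fun a _ => Finset.sum_congr rfl fun b _ => by ring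
  simp only [hscale] at hd
  have heq := hd.unique (hasDerivAt_mul_exp_mul _ (-1) 0)
  simp only [zero_mul, Real.exp_zero, mul_one, hcc] at heq
  have hpos : 0 < spiderwebPotential ℓ m₀ m r := by
    refine lt_of_lt_of_le ?_ (le_newtonPotential (spiderwebMass_nonneg hm₀ hm)
      (spiderwebPosition r) (some (i₀, (0 : Fin ℓ))) (some (i₀, ⟨1, hℓ⟩)))
    have hne : spiderwebPosition r (some (i₀, (0 : Fin ℓ))) -
        spiderwebPosition r (some (i₀, ⟨1, hℓ⟩)) ≠ 0 :=
      sub_ne_zero.mpr ((spiderwebPosition_injective hr).ne (by simp [Fin.ext_iff]))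
    have h1 : 0 < spiderwebMass m₀ m (some (i₀, (0 : Fin ℓ))) := hm i₀
    have h2 : 0 < spiderwebMass m₀ m (some (i₀, (⟨1, hℓ⟩ : Fin ℓ))) := hm i₀
    positivity
  by_contra! hlam
  have : 0 ≤ (ℓ : ℝ) * ∑ i, m i * (lam * r i * r i) :=
    mul_nonneg (Nat.cast_nonneg _) (Finset.sum_nonneg fun i _ =>
      mul_nonneg (hm i).le (mul_nonneg (mul_nonneg hlam (hr.1 i).le) (hr.1 i).le))
  linarith

/-- A spiderweb central configuration is determined by its masses and its constant. -/
theorem isSpiderwebCentralConfiguration_unique (hℓ : 2 ≤ ℓ) {m₀ : ℝ} {m : Fin n → ℝ}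
    (hm₀ : 0 ≤ m₀) (hm : ∀ i, 0 < m i) {lam : ℝ} {r r' : Fin n → ℝ}
    (h : IsSpiderwebCentralConfiguration n ℓ m₀ m lam r)
    (h' : IsSpiderwebCentralConfiguration n ℓ m₀ m lam r') : r = r' := by
  have : NeZero ℓ := ⟨by omega⟩
  have hℓ0 : (0 : ℝ) < ℓ := by exact_mod_cast (by omega : 0 < ℓ)
  obtain ⟨hr, hcc⟩ := (isSpiderwebCentralConfiguration_iff hℓ m₀ m lam r).mp h
  obtain ⟨hr', hcc'⟩ := (isSpiderwebCentralConfiguration_iff hℓ m₀ m lam r').mp h'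
  -- Direction of the segment from `log r` to `log r'`. The ordering of the radii persists along it,
  -- since logarithms are interpolated linearly.
  set d : Fin n → ℝ := fun i => Real.log (r' i) - Real.log (r i) with hd
  have hc : ∀ t i, r i * Real.exp (t * d i) =
      Real.exp ((1 - t) * Real.log (r i) + t * Real.log (r' i)) := by
    intro t i
    nth_rewrite 1 [← Real.exp_log (hr.1 i)]
    rw [← Real.exp_add]
    congr 1
    simp only [hd]
    ring
  have hord : ∀ t ∈ Set.Icc (0 : ℝ) 1, (fun i => r i * Real.exp (t * d i)) ∈ orderedRadii n := by
    rintro t ⟨ht0, ht1⟩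
    refine ⟨fun i => mul_pos (hr.1 i) (Real.exp_pos _), fun i j hij => ?_⟩
    simp only [hc]
    have h1 := Real.log_lt_log (hr.1 i) (hr.2 hij)
    have h2 := Real.log_lt_log (hr'.1 i) (hr'.2 hij)
    rw [Real.exp_lt_exp]
    rcases ht0.eq_or_lt with rfl | ht0
    · simpa using h1
    · exact add_lt_add_of_le_of_lt (mul_le_mul_of_nonneg_left h1.le (by linarith))
        (mul_lt_mul_of_pos_left h2 ht0)
  have hc0 : (fun i => r i * Real.exp (0 * d i)) = r := by simp
  have hc1 : (fun i => r i * Real.exp (1 * d i)) = r' := by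
    funext i
    rw [hc, sub_self, zero_mul, zero_add, one_mul, Real.exp_log (hr'.1 i)]
  have hderiv : ∀ t ∈ Set.Icc (0 : ℝ) 1, _ := fun t ht =>
    hasDerivAt_spiderwebPotential (ℓ := ℓ) m₀ m (c := fun s i => r i * Real.exp (s * d i))
      (t := t) (fun i => hasDerivAt_mul_exp_mul (r i) (d i) t) (hord t ht)
  have hle := (convexOn_spiderwebPotential_exp (ℓ := ℓ) hm₀ hm (convex_Icc 0 1) hr.1
    hord).le_of_hasDerivAt (Set.left_mem_Icc.mpr zero_le_one) (Set.right_mem_Icc.mpr zero_le_one)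
    one_pos (hderiv 0 (Set.left_mem_Icc.mpr zero_le_one))
    (hderiv 1 (Set.right_mem_Icc.mpr zero_le_one))
  rw [hc0, hc1] at hle
  have hterm0 : ∀ i, r i * Real.exp (0 * d i) = r i := fun i => congrFun hc0 i
  have hterm1 : ∀ i, r i * Real.exp (1 * d i) = r' i := fun i => congrFun hc1 i
  simp only [hterm0, hterm1, hcc, hcc'] at hle
  have hsum : 0 ≤ ∑ i, lam * (m i * (d i * (r' i ^ 2 - r i ^ 2))) := by
    have := sub_nonneg.mpr (le_of_mul_le_mul_left hle hℓ0)
    rw [← Finset.sum_sub_distrib] at this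
    refine this.trans_eq (Finset.sum_congr rfl fun i _ => by ring)
  -- An index is needed before `lam < 0` can be deduced; without circles there is nothing to prove.
  funext i₀
  have hlam := neg_of_isSpiderwebCentralConfiguration hℓ hm₀ hm h i₀
  have hmono : ∀ i, r i ≠ r' i → 0 < d i * (r' i ^ 2 - r i ^ 2) := by
    intro i hne
    have hri := hr.1 i
    have hri' := hr'.1 i
    rcases hne.lt_or_gt with hlt | hlt
    · exact mul_pos (sub_pos.mpr (Real.log_lt_log hri hlt))
        (sub_pos.mpr (pow_lt_pow_left₀ hlt hri.le two_ne_zero))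
    · exact mul_pos_of_neg_of_neg (sub_neg.mpr (Real.log_lt_log hri' hlt))
        (sub_neg.mpr (pow_lt_pow_left₀ hlt hri'.le two_ne_zero))
  have hnonpos : ∀ i, lam * (m i * (d i * (r' i ^ 2 - r i ^ 2))) ≤ 0 := by
    intro i
    refine mul_nonpos_of_nonpos_of_nonneg hlam.le (mul_nonneg (hm i).le ?_)
    by_cases hi : r i = r' i
    · simp [hi]
    · exact (hmono i hi).le
  by_contra hne
  have hlt : lam * (m i₀ * (d i₀ * (r' i₀ ^ 2 - r i₀ ^ 2))) < 0 :=
    mul_neg_of_neg_of_pos hlam (mul_pos (hm i₀) (hmono i₀ hne))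
  exact absurd hsum (not_le.mpr (Finset.sum_neg' (fun i _ => hnonpos i) ⟨i₀, Finset.mem_univ _, hlt⟩))

end Uniqueness

theorem mainTheorem2 (n ℓ : ℕ) (hℓ : 2 ≤ ℓ) (m₀ : ℝ) (m : Fin n → ℝ)
    (hm₀ : 0 ≤ m₀) (hm : ∀ i, 0 < m i) (hn : n ≤ 4) :
    (∀ lam : ℝ, lam < 0 → ∃ r : Fin n → ℝ, IsSpiderwebCentralConfiguration n ℓ m₀ m lam r) ∧
      (n = 2 → ∀ (lam : ℝ) (r r' : Fin n → ℝ),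
        IsSpiderwebCentralConfiguration n ℓ m₀ m lam r →
        IsSpiderwebCentralConfiguration n ℓ m₀ m lam r' → r = r') :=
  ⟨fun _ hlam => exists_isSpiderwebCentralConfiguration hℓ hm₀ hm hlam,
    fun _ _ _ _ h h' => isSpiderwebCentralConfiguration_unique hℓ hm₀ hm h h'⟩
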